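/- Let $d,p\in\mathbb N$ and $m>0$. A positive signal with $d$ sources is a discrete measure $F=\sum_{j=1}^d a_j\delta(x-x_j)$ with amplitudes $a_j>0$ and real nodes $x_1<\dots<x_d$; the set of these is $\mathcal P_d^+$, and $\mathcal F[F](s)=\sum_{j=1}^d a_je^{-2\pi i s x_j}$ is the Fourier transform. For $\epsilon,\Omega>0$ let $$E^+_{\epsilon,\Omega}(F)=\{\hat F\in\mathcal P_d^+:\ |\mathcal F[\hat F](\omega)-\mathcal F[F](\omega)|\le\epsilon\ \text{ for all }\omega\in[-\Omega,\Omega]\},$$ and let $E^{+,\mathbf x,j}_{\epsilon,\Omega}(F)\subset\mathbb R$ and $E^{+,\mathbf a,j}_{\epsilon,\Omega}(F)\subset\mathbb R^+$ be the sets of the $j$-th nodes and of the $j$-th amplitudes, respectively, of the signals in $E^+_{\epsilon,\Omega}(F)$. For $0<\tau,\eta\le1$, $0<h\le T$ and $p\ge2$, the node vector $\mathbf x=(x_1,\dots,x_d)$ forms a $(p,h,T,\tau,\eta)$-clustered configuration with cluster $\mathbf x^c=\{x_\kappa,\dots,x_{\kappa+p-1}\}\subset\mathbf x$ if $\tau h\le|x_j-x_k|\le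 h$ for all distinct $x_j,x_k\in\mathbf x^c$, and $\eta T\le|x_\ell-x_j|\le T$ for all $x_\ell\in\mathbf x\setminus\mathbf x^c$ and $x_j\in\mathbf x$ with $j\ne\ell$. **Theorem.** There exist positive constants $C_1,\dots,C_5$, depending only on $d,p,m$, such that the following holds. Let $F=(\mathbf a,\mathbf x)\in\mathcal P_d^+$ be such that $\mathbf x$ forms a $(p,h,T,\tau,\eta)$-clustered configuration with cluster $\mathbf x^c$, and $a_j\ge m$ for every $j=1,\dots,d$. Then, for all $\Omega$ and $\epsilon>0$ with $\frac{C_4}{\eta T}\le\Omega\le\frac{C_5}{h}$ and $\epsilon\le C_3(\Omega\tau h)^{2p-1}$, and for every $j=1,\dots,d$, $$\operatorname{diam}\big(E^{+,\mathbf x,j}_{\epsilon,\Omega}(F)\big)\le\frac{C_1}{\Omega}\,\epsilon\times\begin{cases}(\Omega\tau h)^{-2p+2},&x_j\in\mathbf x^c,\\1,&x_j\in\mathbf x\setminus\mathbf x^c,\end{cases}$$ $$\operatorname{diam}\big(E^{+,\mathbf a,j}_{\epsilon,\Omega}(F)\big)\le C_2\,\epsilon\times\begin{cases}(\Omega\tau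 h)^{-2p+1},&x_j\in\mathbf x^c,\\1,&x_j\in\mathbf x\setminus\mathbf x^c.\end{cases}$$ -/

import Mathlib

open MeasureTheory

noncomputable section

/-- A positive signal `F = ∑ⱼ aⱼ δ(x - xⱼ)` with `d` point sources, identified with its parameters:
positive amplitudes `aⱼ` and real nodes `x₁ < x₂ < ⋯ < x_d` (indexed by `Fin d`). -/
structure PositiveSignal (d : ℕ) where
  /-- the amplitudes -/
  amp : Fin d → ℝ
  /-- the nodes -/
  node : Fin d → ℝ
  amp_pos : ∀ j, 0 < amp j
  node_strictMono : StrictMono node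

namespace PositiveSignal

variable {d : ℕ}

/-- The discrete measure `∑ⱼ aⱼ δ(x - xⱼ)`. -/
def toMeasure (F : PositiveSignal d) : Measure ℝ :=
  ∑ j, ENNReal.ofReal (F.amp j) • Measure.dirac (F.node j)

/-- The Fourier transform `𝓕[F](s) = ∫ e^{-2πi s x} F(dx)`. -/
def fourierTransform (F : PositiveSignal d) (s : ℝ) : ℂ :=
  ∫ x, Complex.exp (-2 * Real.pi * Complex.I * s * x) ∂F.toMeasure

/-- The Fourier transform of a signal is the exponential sum `∑ⱼ aⱼ e^{-2πi s xⱼ}`. -/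
theorem fourierTransform_eq_sum (F : PositiveSignal d) (s : ℝ) :
    F.fourierTransform s =
      ∑ j, (F.amp j : ℂ) * Complex.exp (-2 * Real.pi * Complex.I * s * F.node j) := by
  unfold fourierTransform toMeasure
  rw [integral_finsetSum_measure]
  · refine Finset.sum_congr rfl fun j _ => ?_
    rw [integral_smul_measure, integral_dirac, ENNReal.toReal_ofReal (F.amp_pos j).le,
      Complex.real_smul]
  · intro j _
    exact (integrable_dirac (by simp [enorm_lt_top])).smul_measure ENNReal.ofReal_ne_top

/-- The positive error set: all positive signals with `d` sources whose Fourier transform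
differs from that of `F` by at most `ε` on the band `[-Ω, Ω]`. -/
def errorSet (ε Ω : ℝ) (F : PositiveSignal d) : Set (PositiveSignal d) :=
  {G | ∀ s ∈ Set.Icc (-Ω) Ω, ‖G.fourierTransform s - F.fourierTransform s‖ ≤ ε}

/-- Projection of the positive error set onto the `j`-th node. -/
def nodeErrorSet (ε Ω : ℝ) (F : PositiveSignal d) (j : Fin d) : Set ℝ :=
  (fun G : PositiveSignal d => G.node j) '' errorSet ε Ω F

/-- Projection of the positive error set onto the `j`-th amplitude. -/
def ampErrorSet (ε Ω : ℝ) (F : PositiveSignal d) (j : Fin d) : Set ℝ :=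
  (fun G : PositiveSignal d => G.amp j) '' errorSet ε Ω F

end PositiveSignal

/-- The index set of the `p` consecutive nodes starting at position `κ` (positions start at `0`). -/
def clusterIndices (d p κ : ℕ) : Finset (Fin d) :=
  Finset.univ.filter fun j => κ ≤ (j : ℕ) ∧ (j : ℕ) < κ + p

/-- The node vector `x` forms a `(p, h, T, τ, η)`-clustered configuration whose cluster nodes are
the `p` consecutive nodes starting at position `κ`. -/
structure IsClusteredAt {d : ℕ} (p : ℕ) (h T τ η : ℝ) (x : Fin d → ℝ) (κ : ℕ) : Prop where
  tau_pos : 0 < τ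
  tau_le_one : τ ≤ 1
  eta_pos : 0 < η
  eta_le_one : η ≤ 1
  h_pos : 0 < h
  h_le : h ≤ T
  two_le : 2 ≤ p
  index_le : κ + p ≤ d
  cluster : ∀ j ∈ clusterIndices d p κ, ∀ k ∈ clusterIndices d p κ, j ≠ k →
    τ * h ≤ |x j - x k| ∧ |x j - x k| ≤ h
  nonCluster : ∀ l ∉ clusterIndices d p κ, ∀ j, l ≠ j →
    η * T ≤ |x l - x j| ∧ |x l - x j| ≤ T

end

/-! Subtract the two Fourier transforms: the result is an exponential sum with 2d nodes, those of F
with coefficients `-a j` and those of the competitor with coefficients `b j`, bounded by ε on the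
band. Multiplying each coefficient `c i` by `zeroFactor (z i - z k)` annihilates the node `z k`, at
the cost of one unit of bandwidth and a factor 2 in the bound. Annihilating all nodes but one bounds
that coefficient times the product of its truncated distances to the others
(`norm_coeff_mul_prod_zeroFactor_le`).

After rescaling, cluster nodes are q = Ωτh/d apart and the others at least 2 from every node. As
amplitudes of F are at least m, smallness of ε against q^(2p-1) forces a competing node near every
node of F, and order makes the matching the identity (`abs_sub_lt_localScale_div_four`). Besides the
matched pair, a cluster node then has 2p-2 neighbours at scale q, whence the node exponent. For
amplitudes, all nodes but a matched pair are annihilated (`norm_coeff_add_coeff_le`), which costs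
one more power of q. -/

/-! ### The annihilating factor: Lipschitz and lower bounds. -/

/-- A band-limited function with frequencies in `[0, 1]` whose only real zero is a simple zero
at the origin. -/
noncomputable def zeroFactor (t : ℝ) : ℂ :=
  1 - ∫ s in (0 : ℝ)..1, Complex.exp (Complex.I * (t * s))

theorem zeroFactor_zero : zeroFactor 0 = 0 := by
  simp [zeroFactor]

theorem norm_zeroFactor_sub_le (t u : ℝ) : ‖zeroFactor t - zeroFactor u‖ ≤ |t - u| := by
  have hint : ∀ r : ℝ, IntervalIntegrable
      (fun s : ℝ => Complex.exp (Complex.I * (r * s))) volume 0 1 := fun r =>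
    Continuous.intervalIntegrable (by fun_prop) _ _
  have h : zeroFactor t - zeroFactor u =
      ∫ s in (0 : ℝ)..1, (Complex.exp (Complex.I * (u * s)) - Complex.exp (Complex.I * (t * s))) := by
    rw [intervalIntegral.integral_sub (hint u) (hint t), zeroFactor, zeroFactor]
    ring
  rw [h]
  refine (intervalIntegral.norm_integral_le_of_norm_le_const (C := |t - u|) fun s hs => ?_).trans
    (by simp)
  rw [Set.uIoc_of_le zero_le_one] at hs
  have hfac : Complex.exp (Complex.I * (u * s)) - Complex.exp (Complex.I * (t * s)) =
      Complex.exp (Complex.I * ((t * s : ℝ) : ℂ)) *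
        (Complex.exp (Complex.I * (((u - t) * s : ℝ) : ℂ)) - 1) := by
    rw [mul_sub, ← Complex.exp_add]
    push_cast
    ring_nf
  rw [hfac, norm_mul, Complex.norm_exp_I_mul_ofReal, one_mul]
  refine (Real.norm_exp_I_mul_ofReal_sub_one_le (x := (u - t) * s)).trans ?_
  rw [Real.norm_eq_abs, abs_mul, abs_sub_comm, abs_of_pos hs.1]
  exact mul_le_of_le_one_right (abs_nonneg _) hs.2

theorem zeroFactor_mul_self (t : ℝ) :
    zeroFactor t * t = ((t - Real.sin t : ℝ) : ℂ) - ((1 - Real.cos t : ℝ) : ℂ) * Complex.I := by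
  rcases eq_or_ne t 0 with rfl | ht
  · simp
  have hc : Complex.I * (t : ℂ) ≠ 0 := mul_ne_zero Complex.I_ne_zero (by exact_mod_cast ht)
  have h : (∫ s in (0 : ℝ)..1, Complex.exp (Complex.I * (t * s))) =
      (Complex.exp (Complex.I * t) - 1) / (Complex.I * t) := by
    simpa [mul_assoc] using integral_exp_mul_complex (a := 0) (b := 1) hc
  have ht' : (t : ℂ) ≠ 0 := by exact_mod_cast ht
  rw [zeroFactor, h, mul_comm Complex.I (t : ℂ), Complex.exp_mul_I]
  push_cast
  field_simp
  ring_nf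
  simp only [Complex.I_sq]
  ring

/-- After multiplication by t, the imaginary part 1 - cos t ≥ 2t²/π² serves for |t| ≤ π and the real
part t - sin t beyond. The 5 comes from π² < 10. -/
theorem min_one_abs_le_norm_zeroFactor (t : ℝ) : min 1 |t| / 5 ≤ ‖zeroFactor t‖ := by
  rcases eq_or_ne t 0 with rfl | ht
  · simp
  have hpos : 0 < |t| := abs_pos.2 ht
  have hre : (zeroFactor t * t).re = t - Real.sin t := by
    rw [zeroFactor_mul_self, Complex.sub_re, Complex.ofReal_re, Complex.re_ofReal_mul]
    simp
  have him : (zeroFactor t * t).im = -(1 - Real.cos t) := by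
    rw [zeroFactor_mul_self, Complex.sub_im, Complex.ofReal_im, Complex.im_ofReal_mul]
    simp
  have hnorm : ‖zeroFactor t * t‖ = ‖zeroFactor t‖ * |t| := by simp
  refine le_of_mul_le_mul_right ?_ hpos
  rw [← hnorm]
  rcases le_total |t| Real.pi with hle | hge
  · have h1 := Complex.abs_im_le_norm (zeroFactor t * t)
    rw [him, abs_neg] at h1
    have h2 := Real.cos_le_one_sub_mul_cos_sq hle
    have h3 : 1 / 5 ≤ 2 / Real.pi ^ 2 := by
      rw [div_le_div_iff₀ (by norm_num) (by positivity)]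
      nlinarith [Real.pi_lt_d2, Real.pi_pos]
    have h4 : 1 / 5 * t ^ 2 ≤ 2 / Real.pi ^ 2 * t ^ 2 := by gcongr
    have h5 : min 1 |t| * |t| ≤ |t| * |t| := by gcongr; exact min_le_right _ _
    rw [abs_mul_abs_self] at h5
    have h6 := le_abs_self (1 - Real.cos t)
    nlinarith
  · have h1 := Complex.abs_re_le_norm (zeroFactor t * t)
    rw [hre] at h1
    have h2 : |t| ≤ |t - Real.sin t| + |Real.sin t| := by
      simpa using abs_add_le (t - Real.sin t) (Real.sin t)
    have h3 := Real.abs_sin_le_one t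
    have h4 := Real.pi_gt_three
    have h5 : min 1 |t| ≤ 1 := min_le_left _ _
    nlinarith

-- Multiplying coefficients by `zeroFactor (z i - z k)` subtracts from the sum an average of its
-- modulated translates by t ∈ [0, 1]. Hence each factor doubles the bound and consumes one unit of
-- band.
open Complex in
theorem norm_sum_mul_prod_zeroFactor_le {ι : Type*} [Fintype ι] (z : ι → ℝ) (T : Finset ι) :
    ∀ (c : ι → ℂ) (B ε : ℝ),
      (∀ s : ℝ, |s| ≤ B + T.card → ‖∑ i, c i * exp (I * (s * z i))‖ ≤ ε) →
      ∀ s : ℝ, |s| ≤ B →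
        ‖∑ i, (c i * ∏ k ∈ T, zeroFactor (z i - z k)) * exp (I * (s * z i))‖ ≤ 2 ^ T.card * ε := by
  classical
  induction T using Finset.induction_on with
  | empty =>
    intro c B ε h s hs
    simpa using h s (by simpa using hs)
  | insert k T hk ih =>
    intro c B ε h s hs
    have hcard : ((insert k T).card : ℝ) = T.card + 1 := by
      rw [Finset.card_insert_of_notMem hk]; push_cast; rfl
    have step : ∀ s : ℝ, |s| ≤ B + T.card →
        ‖∑ i, (c i * zeroFactor (z i - z k)) * exp (I * (s * z i))‖ ≤ 2 * ε := by
      intro s hs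
      have hexp : ∀ i (t : ℝ), exp (I * (((z i - z k : ℝ) : ℂ) * t)) * exp (I * (s * z i)) =
          exp (I * ((s + t : ℝ) * z i)) * exp (I * ((-(t * z k) : ℝ) : ℂ)) := by
        intro i t
        rw [← exp_add, ← exp_add]
        push_cast
        ring_nf
      have heq : ∑ i, (c i * zeroFactor (z i - z k)) * exp (I * (s * z i)) =
          ∑ i, c i * exp (I * (s * z i)) -
            ∫ t in (0 : ℝ)..1, (∑ i, c i * exp (I * ((s + t : ℝ) * z i))) *
              exp (I * ((-(t * z k) : ℝ) : ℂ)) := by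
        simp_rw [Finset.sum_mul]
        rw [intervalIntegral.integral_finsetSum
          (fun i _ => Continuous.intervalIntegrable (by fun_prop) _ _), ← Finset.sum_sub_distrib]
        refine Finset.sum_congr rfl fun i _ => ?_
        simp_rw [mul_assoc (c i), ← hexp]
        rw [intervalIntegral.integral_const_mul, intervalIntegral.integral_mul_const, zeroFactor]
        ring
      rw [heq]
      refine (norm_sub_le _ _).trans ?_
      have h1 := h s (by rw [hcard]; linarith)
      have h2 : ‖∫ t in (0 : ℝ)..1, (∑ i, c i * exp (I * ((s + t : ℝ) * z i))) *
              exp (I * ((-(t * z k) : ℝ) : ℂ))‖ ≤ ε * |1 - 0| := by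
        refine intervalIntegral.norm_integral_le_of_norm_le_const fun t ht => ?_
        rw [Set.uIoc_of_le zero_le_one] at ht
        rw [norm_mul, Complex.norm_exp_I_mul_ofReal, mul_one]
        refine h _ ?_
        rw [hcard]
        have := abs_add_le s t
        rw [abs_of_pos ht.1] at this
        linarith [ht.2]
      simp only [sub_zero, abs_one, mul_one] at h2
      linarith
    have := ih (fun i => c i * zeroFactor (z i - z k)) B (2 * ε) step s hs
    rw [Finset.card_insert_of_notMem hk, pow_succ, mul_assoc]
    simpa only [Finset.prod_insert hk, mul_assoc] using this

/-! ### Bounds for one coefficient and for the sum of two nearby ones. -/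

section CoefficientBounds

variable {ι : Type*} {z : ι → ℝ}

theorem prod_zeroFactor_eq_zero {T : Finset ι} {i : ι} (hi : i ∈ T) :
    ∏ k ∈ T, zeroFactor (z i - z k) = 0 :=
  Finset.prod_eq_zero hi (by rw [sub_self, zeroFactor_zero])

variable [Fintype ι] {c : ι → ℂ} {ε : ℝ}

theorem norm_sum_mul_prod_zeroFactor_le_of_card
    (h : ∀ s : ℝ, |s| ≤ Fintype.card ι → ‖∑ i, c i * Complex.exp (Complex.I * (s * z i))‖ ≤ ε)
    (T : Finset ι) :
    ‖∑ i, c i * ∏ k ∈ T, zeroFactor (z i - z k)‖ ≤ 2 ^ Fintype.card ι * ε := by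
  have hε : 0 ≤ ε := (norm_nonneg _).trans (h 0 (by simp))
  have hT : (T.card : ℝ) ≤ Fintype.card ι := by exact_mod_cast T.card_le_univ
  have h1 := norm_sum_mul_prod_zeroFactor_le z T c 0 ε
    (fun s hs => h s (by linarith)) 0 (by simp)
  simp only [Complex.ofReal_zero, zero_mul, mul_zero, Complex.exp_zero, mul_one] at h1
  refine h1.trans ?_
  gcongr
  · norm_num
  · exact T.card_le_univ

variable [DecidableEq ι]

theorem norm_coeff_mul_prod_zeroFactor_le
    (h : ∀ s : ℝ, |s| ≤ Fintype.card ι → ‖∑ i, c i * Complex.exp (Complex.I * (s * z i))‖ ≤ ε)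
    (j : ι) :
    ‖c j‖ * ∏ k ∈ Finset.univ.erase j, ‖zeroFactor (z j - z k)‖ ≤ 2 ^ Fintype.card ι * ε := by
  have h1 := norm_sum_mul_prod_zeroFactor_le_of_card h (Finset.univ.erase j)
  rw [Finset.sum_eq_single j (fun i _ hij => by
    rw [prod_zeroFactor_eq_zero (by simpa using hij), mul_zero]) (by simp)] at h1
  simpa using h1

theorem exp_sub_one_le_mul_exp (x : ℝ) : Real.exp x - 1 ≤ x * Real.exp x := by
  have h1 := Real.add_one_le_exp (-x)
  have h2 : Real.exp (-x) * Real.exp x = 1 := by rw [← Real.exp_add]; simp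
  nlinarith [Real.exp_pos x]

/-- With all other nodes annihilated, `c j * f j + c j' * f j'` is small. Replacing `f j'` by `f j`
costs `‖c j'‖` times a quantity of order r = |z j - z j'|, while the single-coefficient bound for `c
j'` is of order 1/r; the powers of r cancel. -/
theorem norm_coeff_add_coeff_le
    (h : ∀ s : ℝ, |s| ≤ Fintype.card ι → ‖∑ i, c i * Complex.exp (Complex.I * (s * z i))‖ ≤ ε)
    {j j' : ι} (hjj' : j ≠ j') {A ρ M : ℝ} (hA : 0 < A) (hρ : 0 < ρ)
    (hAj : A ≤ ∏ k ∈ (Finset.univ.erase j).erase j', ‖zeroFactor (z j - z k)‖)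
    (hAj' : A ≤ ∏ k ∈ (Finset.univ.erase j).erase j', ‖zeroFactor (z j' - z k)‖)
    (hsep : ∀ k ∈ (Finset.univ.erase j).erase j', ρ ≤ ‖zeroFactor (z j - z k)‖)
    (h1 : |z j - z j'| ≤ 1) (hM : |z j - z j'| ≤ M * ρ) :
    ‖c j + c j'‖ ≤ 2 ^ Fintype.card ι * ε / A *
      (1 + 5 * (Fintype.card ι / ρ) * Real.exp (Fintype.card ι * M)) := by
  set T := (Finset.univ.erase j).erase j' with hT
  set N : ℕ := Fintype.card ι
  set r := |z j - z j'|
  set f : ι → ℂ := fun i => ∏ k ∈ T, zeroFactor (z i - z k)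
  have hfj : A ≤ ‖f j‖ := by simpa [f] using hAj
  have hfj0 : f j ≠ 0 := by
    rw [← norm_pos_iff]; exact hA.trans_le hfj
  have hcj' : ‖c j'‖ * r ≤ 5 * (2 ^ N * ε / A) := by
    have h2 := norm_coeff_mul_prod_zeroFactor_le h j'
    have hmem : j ∈ Finset.univ.erase j' := by simp [hjj']
    rw [← Finset.mul_prod_erase _ _ hmem, Finset.erase_right_comm, ← hT] at h2
    have h3 := min_one_abs_le_norm_zeroFactor (z j' - z j)
    rw [abs_sub_comm, min_eq_right h1] at h3
    have h4 : ‖c j'‖ * (r / 5 * A) ≤ 2 ^ N * ε := le_trans (by gcongr) h2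
    rw [mul_div_assoc', le_div_iff₀ hA]
    linarith
  have hsum : ‖c j * f j + c j' * f j'‖ ≤ 2 ^ N * ε := by
    have h2 := norm_sum_mul_prod_zeroFactor_le_of_card h T
    rwa [Fintype.sum_eq_add j j' hjj' (fun i hi => by
      rw [prod_zeroFactor_eq_zero (by simp [hT, hi]), mul_zero])] at h2
  have hratio : ‖f j' / f j - 1‖ ≤ N / ρ * r * Real.exp (N * M) := by
    have h2 : f j' / f j = ∏ k ∈ T, (1 + (zeroFactor (z j' - z k) / zeroFactor (z j - z k) - 1)) := by
      simp [f, Finset.prod_div_distrib]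
    rw [h2]
    refine (Finset.norm_prod_one_add_sub_one_le _ _).trans ?_
    have h3 : ∑ k ∈ T, ‖zeroFactor (z j' - z k) / zeroFactor (z j - z k) - 1‖ ≤ N / ρ * r := by
      have h4 : ∀ k ∈ T, ‖zeroFactor (z j' - z k) / zeroFactor (z j - z k) - 1‖ ≤ r / ρ := by
        intro k hk
        have hpos : 0 < ‖zeroFactor (z j - z k)‖ := hρ.trans_le (hsep k hk)
        rw [div_sub_one (norm_pos_iff.1 hpos), norm_div]
        have h5 := norm_zeroFactor_sub_le (z j' - z k) (z j - z k)
        rw [sub_sub_sub_cancel_right, abs_sub_comm] at h5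
        exact div_le_div₀ (abs_nonneg _) h5 hρ (hsep k hk)
      refine (Finset.sum_le_card_nsmul _ _ _ h4).trans ?_
      rw [nsmul_eq_mul, div_mul_eq_mul_div, mul_div_assoc]
      gcongr
      exact T.card_le_univ
    have h5 : N / ρ * r ≤ N * M := by
      rw [div_mul_eq_mul_div, mul_div_assoc]
      gcongr
      rwa [div_le_iff₀ hρ]
    calc _ ≤ Real.exp (N / ρ * r) - 1 := by gcongr
      _ ≤ N / ρ * r * Real.exp (N / ρ * r) := exp_sub_one_le_mul_exp _
      _ ≤ _ := by gcongr
  have hdecomp : c j + c j' = (c j * f j + c j' * f j') / f j - c j' * (f j' / f j - 1) := by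
    field_simp
    ring
  have h6 : ‖(c j * f j + c j' * f j') / f j‖ ≤ 2 ^ N * ε / A := by
    rw [norm_div]
    exact div_le_div₀ ((norm_nonneg _).trans hsum) hsum hA hfj
  have h7 : ‖c j' * (f j' / f j - 1)‖ ≤
      5 * (2 ^ N * ε / A) * (N / ρ * Real.exp (N * M)) := by
    rw [norm_mul]
    calc _ ≤ ‖c j'‖ * (N / ρ * r * Real.exp (N * M)) := by gcongr
      _ = ‖c j'‖ * r * (N / ρ * Real.exp (N * M)) := by ring
      _ ≤ _ := by gcongr
  rw [hdecomp]
  refine (norm_sub_le _ _).trans ?_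
  linarith

end CoefficientBounds

/-! ### Pairing the nodes of the two signals. -/

section Matching

variable {d : ℕ} {S : Finset (Fin d)} {q : ℝ}

theorem prod_erase_ite_mem (S : Finset (Fin d)) (q : ℝ) (j : Fin d) :
    ∏ k ∈ Finset.univ.erase j, (if k ∈ S then q else 1) = q ^ (S.erase j).card := by
  rw [Finset.prod_ite_mem, Finset.prod_const]
  congr 2
  ext k
  simp

/-- The local resolution at a node: `q` inside the cluster `S`, and `1` outside. -/
noncomputable def localScale (S : Finset (Fin d)) (q : ℝ) (j : Fin d) : ℝ := if j ∈ S then q else 1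

theorem localScale_pos (hq : 0 < q) (j : Fin d) : 0 < localScale S q j := by
  unfold localScale; split_ifs <;> linarith

theorem localScale_le_one (hq : q ≤ 1) (j : Fin d) : localScale S q j ≤ 1 := by
  unfold localScale; split_ifs <;> linarith

theorem eq_id_of_strictMono {ψ : Fin d → Fin d} (h : StrictMono ψ) (j : Fin d) : ψ j = j :=
  le_antisymm (h.le_id j) (h.id_le j)

/-- If no `Y k` were near `X j`, both products in `key` would be bounded below, contradicting `hE`.
-/
theorem abs_sub_lt_localScale_div_four {X Y : Fin d → ℝ} {m E : ℝ}
    (hX : StrictMono X) (hY : StrictMono Y) (hq0 : 0 < q) (hq1 : q ≤ 1) (hm : 0 < m)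
    (hS : ∀ i ∈ S, ∀ j ∈ S, i ≠ j → q ≤ |X i - X j|)
    (hN : ∀ i ∉ S, ∀ j, i ≠ j → 2 ≤ |X i - X j|)
    (key : ∀ j, m * (∏ k ∈ Finset.univ.erase j, min 1 |X j - X k|) * ∏ k, min 1 |X j - Y k| ≤ E)
    (hE : E < m * (1 / 4) ^ d * q ^ (2 * S.card - 1)) (j : Fin d) :
    |X j - Y j| < localScale S q j / 4 := by
  have hN' : ∀ i j, i ∉ S → j ≠ i → 2 ≤ |X j - X i| := fun i j hi hij => by
    rw [abs_sub_comm]; exact hN i hi j hij.symm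
  have hnn : ∀ i k, 0 ≤ min 1 |X i - Y k| := fun i k => le_min zero_le_one (abs_nonneg _)
  have far : ∀ j, ∃ k, j ∉ S → |X j - Y k| < 1 / 4 := by
    intro j
    by_cases hj : j ∈ S
    · exact ⟨j, fun h => absurd hj h⟩
    by_contra! hcon
    have h1 : ∏ k ∈ Finset.univ.erase j, min 1 |X j - X k| = 1 :=
      Finset.prod_eq_one fun k hk => min_eq_left <| by
        linarith [hN j hj k (Finset.ne_of_mem_erase hk).symm]
    have h2 : (1 / 4 : ℝ) ^ d ≤ ∏ k, min 1 |X j - Y k| := by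
      have := Finset.prod_le_prod (s := Finset.univ) (f := fun _ : Fin d => (1 / 4 : ℝ))
        (g := fun k => min 1 |X j - Y k|) (fun _ _ => by norm_num)
        (fun k _ => le_min (by norm_num) (hcon k).2)
      simpa using this
    have h3 := key j
    rw [h1, mul_one] at h3
    have h4 : m * (1 / 4) ^ d ≤ m * ∏ k, min 1 |X j - Y k| := by gcongr
    have h5 : m * (1 / 4) ^ d * q ^ (2 * S.card - 1) ≤ m * (1 / 4) ^ d * 1 := by
      gcongr; exact pow_le_one₀ hq0.le hq1
    linarith
  choose φ hφ using far
  have hφinj : Set.InjOn φ (Sᶜ : Finset (Fin d)) := by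
    intro i hi k hk hik
    by_contra hne
    have h1 := hφ i (by simpa using hi)
    have h2 := hφ k (by simpa using hk)
    have h3 := hN i (by simpa using hi) k hne
    rw [hik] at h1
    rw [abs_sub_comm] at h2
    linarith [abs_sub_le (X i) (Y (φ k)) (X k)]
  have near : ∀ j, ∃ k, |X j - Y k| < localScale S q j / 4 := by
    intro j
    by_cases hj : j ∈ S
    swap
    · exact ⟨φ j, by simpa [localScale, hj] using hφ j hj⟩
    by_contra! hcon
    simp only [localScale, hj, if_true] at hcon
    obtain ⟨n, hn⟩ : ∃ n, S.card = n + 1 :=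
      ⟨S.card - 1, by have := Finset.card_pos.2 ⟨j, hj⟩; omega⟩
    have h1 : q ^ n ≤ ∏ k ∈ Finset.univ.erase j, min 1 |X j - X k| := by
      have h2 := prod_erase_ite_mem S q j
      rw [Finset.card_erase_of_mem hj, hn, Nat.add_sub_cancel] at h2
      rw [← h2]
      refine Finset.prod_le_prod (fun k _ => by split_ifs <;> linarith) fun k hk => ?_
      have hkj := Finset.ne_of_mem_erase hk
      split_ifs with hk'
      · exact le_min hq1 (hS j hj k hk' hkj.symm)
      · exact le_min le_rfl (by linarith [hN' k j hk' hkj.symm])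
    -- The `Y`-nodes claimed by nodes outside `S` lie at distance over 1 from `X j` and contribute
    -- factors 1. By injectivity of `φ`, exactly `S.card` nodes `Y k` remain, each contributing at
    -- least q/4.
    set R := (Sᶜ).image φ with hR
    have hRcard : (Rᶜ).card = n + 1 := by
      have h3 : R.card = (Sᶜ).card := Finset.card_image_of_injOn hφinj
      have h4 := Finset.card_compl S
      have h5 := Finset.card_compl R
      have h6 := S.card_le_univ
      rw [Fintype.card_fin] at h4 h5 h6
      omega
    have h2 : (q / 4) ^ (n + 1) ≤ ∏ k, min 1 |X j - Y k| := by
      have h3 : ∏ k : Fin d, (if k ∈ Rᶜ then q / 4 else 1) = (q / 4) ^ (n + 1) := by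
        rw [Finset.prod_ite_mem, Finset.prod_const, Finset.univ_inter, hRcard]
      rw [← h3]
      refine Finset.prod_le_prod (fun k _ => by split_ifs <;> linarith) fun k _ => ?_
      split_ifs with hk
      · exact le_min (by linarith) (hcon k)
      · simp only [Finset.mem_compl, not_not, hR, Finset.mem_image] at hk
        obtain ⟨i, hi, rfl⟩ := hk
        have hij : i ≠ j := fun h => hi (h ▸ hj)
        have h4 := hφ i hi
        rw [abs_sub_comm] at h4
        refine le_min le_rfl ?_
        linarith [hN' i j hi hij.symm, abs_sub_le (X j) (Y (φ i)) (X i)]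
    have h4 : m * q ^ n * (q / 4) ^ (n + 1) ≤ E := by
      refine le_trans ?_ (key j)
      gcongr
    have h5 : (1 / 4 : ℝ) ^ d ≤ (1 / 4) ^ (n + 1) :=
      pow_le_pow_of_le_one (by norm_num) (by norm_num)
        (by have := S.card_le_univ; rw [Fintype.card_fin] at this; omega)
    have h6 : m * q ^ n * (q / 4) ^ (n + 1) = m * (1 / 4) ^ (n + 1) * q ^ (2 * S.card - 1) := by
      rw [hn, show 2 * (n + 1) - 1 = n + (n + 1) by omega, pow_add, div_eq_mul_one_div q, mul_pow]
      ring
    have h7 : m * (1 / 4) ^ d * q ^ (2 * S.card - 1) ≤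
        m * (1 / 4) ^ (n + 1) * q ^ (2 * S.card - 1) := by gcongr
    linarith
  choose ψ hψ using near
  -- The radii of the matching intervals sum to at most the gap between their centres, so the order
  -- of the nodes passes to their partners; a strictly monotone self-map of `Fin d` is the identity.
  have hmono : StrictMono ψ := by
    intro i k hik
    have hgap : localScale S q i / 4 + localScale S q k / 4 ≤ X k - X i := by
      have h0 : X k - X i = |X k - X i| := (abs_of_pos (sub_pos.2 (hX hik))).symm
      rw [h0]
      by_cases hi : i ∈ S
      · by_cases hk : k ∈ S
        · simp only [localScale, hi, hk, if_true]
          linarith [hS k hk i hi hik.ne']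
        · simp only [localScale, hi, hk, if_true, if_false]
          linarith [hN k hk i hik.ne']
      · linarith [hN' i k hi hik.ne', localScale_le_one (S := S) hq1 i,
          localScale_le_one (S := S) hq1 k]
    rw [← hY.lt_iff_lt]
    have h1 := abs_lt.1 (hψ i)
    have h2 := abs_lt.1 (hψ k)
    linarith
  have := hψ j
  rwa [eq_id_of_strictMono hmono] at this

end Matching

/-! ### Error bounds for two signals at normalized scale. -/

section TwoSignals

variable {d : ℕ} {S : Finset (Fin d)} {q : ℝ}

theorem erase_inl_eq_disjSum (j : Fin d) :
    (Finset.univ : Finset (Fin d ⊕ Fin d)).erase (Sum.inl j) =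
      (Finset.univ.erase j).disjSum Finset.univ := by
  ext (k | k) <;> simp

theorem erase_inl_erase_inr_eq_disjSum (j : Fin d) :
    ((Finset.univ : Finset (Fin d ⊕ Fin d)).erase (Sum.inl j)).erase (Sum.inr j) =
      (Finset.univ.erase j).disjSum (Finset.univ.erase j) := by
  ext (k | k) <;> simp

/-- The 10 combines the 2 lost in separation with the 5 of `min_one_abs_le_norm_zeroFactor`. For j
outside `S` the local scale is 1, so one formula covers both cases. -/
theorem localScale_pow_div_le_prod_zeroFactor {x : ℝ} {X : Fin d → ℝ} {j : Fin d}
    (hq0 : 0 < q) (hq1 : q ≤ 1)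
    (hsep : ∀ k, k ≠ j → (if j ∈ S then localScale S q k else 1) / 2 ≤ |x - X k|) :
    localScale S q j ^ (S.card - 1) / 10 ^ d ≤
      ∏ k ∈ Finset.univ.erase j, ‖zeroFactor (x - X k)‖ := by
  have hw : ∀ k, 0 < (if j ∈ S then localScale S q k else 1) ∧
      (if j ∈ S then localScale S q k else 1) ≤ 1 := fun k => by
    split_ifs
    · exact ⟨localScale_pos hq0 k, localScale_le_one hq1 k⟩
    · norm_num
  have h1 : ∏ k ∈ Finset.univ.erase j, (if j ∈ S then localScale S q k else 1) / 10 ≤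
      ∏ k ∈ Finset.univ.erase j, ‖zeroFactor (x - X k)‖ := by
    refine Finset.prod_le_prod (fun k _ => by linarith [(hw k).1]) fun k hk => ?_
    refine le_trans ?_ (min_one_abs_le_norm_zeroFactor _)
    have h2 := hsep k (Finset.ne_of_mem_erase hk)
    have h3 : (if j ∈ S then localScale S q k else 1) / 2 ≤ min 1 |x - X k| :=
      le_min (by linarith [(hw k).2]) h2
    linarith
  refine le_trans ?_ h1
  rw [Finset.prod_div_distrib, Finset.prod_const]
  have h4 : ∏ k ∈ Finset.univ.erase j, (if j ∈ S then localScale S q k else 1) =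
      localScale S q j ^ (S.card - 1) := by
    by_cases hj : j ∈ S
    · simp only [hj, if_true, localScale]
      rw [prod_erase_ite_mem, Finset.card_erase_of_mem hj]
    · simp [hj, localScale]
  rw [h4]
  have h5 := localScale_pos (S := S) hq0 j
  gcongr
  · norm_num
  · simp

variable {X Y a b : Fin d → ℝ} {m ε : ℝ}

theorem localized_bounds
    (hX : StrictMono X) (hY : StrictMono Y) (hq0 : 0 < q) (hq1 : q ≤ 1) (hm : 0 < m)
    (hS : ∀ i ∈ S, ∀ j ∈ S, i ≠ j → q ≤ |X i - X j|)
    (hN : ∀ i ∉ S, ∀ j, i ≠ j → 2 ≤ |X i - X j|)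
    (ha : ∀ j, m ≤ a j)
    (hsum : ∀ s : ℝ, |s| ≤ 2 * d → ‖∑ j, (b j : ℂ) * Complex.exp (Complex.I * (s * Y j)) -
      ∑ j, (a j : ℂ) * Complex.exp (Complex.I * (s * X j))‖ ≤ ε)
    (hε : ε ≤ m / 2 * (1 / 400) ^ d * q ^ (2 * S.card - 1)) (j : Fin d) :
    |Y j - X j| ≤ 5 * 400 ^ d / m * ε / localScale S q j ^ (2 * (S.card - 1)) ∧
    |b j - a j| ≤ 400 ^ d * (1 + 100 * d * Real.exp (5 * d)) * ε /
      localScale S q j ^ (2 * (S.card - 1) + 1) := by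
  set z : Fin d ⊕ Fin d → ℝ := Sum.elim X Y with hz
  set c : Fin d ⊕ Fin d → ℂ := Sum.elim (fun j => -(a j : ℂ)) (fun j => (b j : ℂ)) with hc
  have hε0 : 0 ≤ ε := (norm_nonneg _).trans (hsum 0 (by simp))
  have hcard : Fintype.card (Fin d ⊕ Fin d) = 2 * d := by simp; omega
  have hz' : ∀ s : ℝ, |s| ≤ Fintype.card (Fin d ⊕ Fin d) →
      ‖∑ i, c i * Complex.exp (Complex.I * (s * z i))‖ ≤ ε := by
    intro s hs
    rw [hcard] at hs
    convert hsum s (by exact_mod_cast hs) using 2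
    simp [hz, hc, Fintype.sum_sum_type]
    ring
  have hpow : (2 : ℝ) ^ Fintype.card (Fin d ⊕ Fin d) = 4 ^ d := by
    rw [hcard, pow_mul]; norm_num
  have haj : ∀ j, m ≤ ‖c (Sum.inl j)‖ := fun j => by
    simpa [hc] using (ha j).trans (le_abs_self _)
  -- 100 = 4 · 5 · 5: a factor 2^(2d) from annihilation and 5 for each node of `X` and `Y`.
  have key : ∀ j, m * (∏ k ∈ Finset.univ.erase j, min 1 |X j - X k|) *
      ∏ k, min 1 |X j - Y k| ≤ 100 ^ d * ε := by
    intro j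
    have h1 := norm_coeff_mul_prod_zeroFactor_le hz' (Sum.inl j)
    rw [erase_inl_eq_disjSum, Finset.prod_disjSum, hpow] at h1
    have hmin : ∀ t : ℝ, 0 ≤ min 1 |t| := fun t => le_min zero_le_one (abs_nonneg _)
    have h2 : (∏ k ∈ Finset.univ.erase j, min 1 |X j - X k|) / 5 ^ d ≤
        ∏ k ∈ Finset.univ.erase j, ‖zeroFactor (X j - X k)‖ := by
      refine le_trans ?_ (Finset.prod_le_prod (fun k _ => div_nonneg (hmin _) (by norm_num))
        (fun k _ => min_one_abs_le_norm_zeroFactor (X j - X k)))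
      rw [Finset.prod_div_distrib, Finset.prod_const]
      have := Finset.prod_nonneg (s := Finset.univ.erase j) fun k _ => hmin (X j - X k)
      gcongr
      · norm_num
      · simp
    have h3 : (∏ k, min 1 |X j - Y k|) / 5 ^ d ≤ ∏ k, ‖zeroFactor (X j - Y k)‖ := by
      refine le_trans ?_ (Finset.prod_le_prod (fun k _ => div_nonneg (hmin _) (by norm_num))
        (fun k _ => min_one_abs_le_norm_zeroFactor (X j - Y k)))
      rw [Finset.prod_div_distrib, Finset.prod_const]
      simp
    have h4 : m * ((∏ k ∈ Finset.univ.erase j, min 1 |X j - X k|) / 5 ^ d *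
        ((∏ k, min 1 |X j - Y k|) / 5 ^ d)) ≤ 4 ^ d * ε := by
      refine le_trans ?_ h1
      have := Finset.prod_nonneg (s := Finset.univ) fun k _ => hmin (X j - Y k)
      refine mul_le_mul (haj j) (mul_le_mul h2 h3 (by positivity) (by positivity)) ?_ (by positivity)
      have := Finset.prod_nonneg (s := Finset.univ.erase j) fun k _ => hmin (X j - X k)
      positivity
    have h5 : (100 : ℝ) ^ d = 4 ^ d * 5 ^ d * 5 ^ d := by rw [← mul_pow, ← mul_pow]; norm_num
    calc _ = m * ((∏ k ∈ Finset.univ.erase j, min 1 |X j - X k|) / 5 ^ d *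
        ((∏ k, min 1 |X j - Y k|) / 5 ^ d)) * (5 ^ d * 5 ^ d) := by field_simp
      _ ≤ 4 ^ d * ε * (5 ^ d * 5 ^ d) := by gcongr
      _ = _ := by rw [h5]; ring
  have hE : 100 ^ d * ε < m * (1 / 4) ^ d * q ^ (2 * S.card - 1) := by
    have h1 : 0 < m * (1 / 4) ^ d * q ^ (2 * S.card - 1) := by positivity
    have h2 : (100 : ℝ) ^ d * (1 / 400) ^ d = (1 / 4) ^ d := by rw [← mul_pow]; norm_num
    calc 100 ^ d * ε ≤ 100 ^ d * (m / 2 * (1 / 400) ^ d * q ^ (2 * S.card - 1)) := by gcongr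
      _ = m * (1 / 4) ^ d * q ^ (2 * S.card - 1) / 2 := by rw [← h2]; ring
      _ < _ := by linarith
  have hloc := abs_sub_lt_localScale_div_four hX hY hq0 hq1 hm hS hN key hE
  have hg0 := fun j => localScale_pos (S := S) hq0 j
  have hg1 := fun j => localScale_le_one (S := S) hq1 j
  have hXX : ∀ i k, k ≠ i → (if i ∈ S then localScale S q k else 1) ≤ |X i - X k| ∧
      localScale S q i ≤ |X i - X k| ∧ localScale S q k ≤ |X i - X k| := by
    intro i k hki
    by_cases hi : i ∈ S
    · simp only [hi, if_true]
      by_cases hk : k ∈ S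
      · simp only [localScale, hi, hk, if_true]
        have := hS i hi k hk hki.symm
        exact ⟨this, this, this⟩
      · have := hN k hk i hki
        rw [abs_sub_comm] at this
        refine ⟨?_, ?_, ?_⟩ <;> linarith [hg1 i, hg1 k]
    · have := hN i hi k hki.symm
      simp only [hi, if_false]
      refine ⟨?_, ?_, ?_⟩ <;> linarith [hg1 i, hg1 k]
  -- Each node moves by less than a quarter of its local scale, so separations at most halve when
  -- `X`-nodes are replaced by `Y`-nodes.
  have hXY : ∀ i k, k ≠ i → |X i - X k| / 2 ≤ |X i - Y k| := fun i k hki => by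
    have h1 := abs_sub_le (X i) (Y k) (X k)
    rw [abs_sub_comm (Y k)] at h1
    linarith [(hXX i k hki).2.2, hloc k, hg0 k]
  have hYX : ∀ i k, k ≠ i → |X i - X k| / 2 ≤ |Y i - X k| := fun i k hki => by
    have h1 := abs_sub_le (X i) (Y i) (X k)
    linarith [(hXX i k hki).2.1, hloc i, hg0 i]
  have hYY : ∀ i k, k ≠ i → |X i - X k| / 2 ≤ |Y i - Y k| := fun i k hki => by
    have h1 := abs_sub_le (X i) (Y i) (X k)
    have h2 := abs_sub_le (Y i) (Y k) (X k)
    rw [abs_sub_comm (Y k)] at h2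
    linarith [(hXX i k hki).2.1, (hXX i k hki).2.2, hloc i, hloc k]
  have hhalf : ∀ i k (u : ℝ), k ≠ i → |X i - X k| / 2 ≤ u →
      (if i ∈ S then localScale S q k else 1) / 2 ≤ u := fun i k u hki hu => by
    linarith [(hXX i k hki).1]
  set A : ℝ := localScale S q j ^ (2 * (S.card - 1)) / 100 ^ d with hA
  have hgj := hg0 j
  have hA0 : 0 < A := by positivity
  have hAeq : A = localScale S q j ^ (S.card - 1) / 10 ^ d *
      (localScale S q j ^ (S.card - 1) / 10 ^ d) := by
    have h5 : (100 : ℝ) ^ d = 10 ^ d * 10 ^ d := by rw [← mul_pow]; norm_num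
    rw [hA, h5, two_mul, pow_add]
    field_simp
  have hAj : A ≤ ∏ k ∈ (Finset.univ.erase (Sum.inl j)).erase (Sum.inr j),
      ‖zeroFactor (z (Sum.inl j) - z k)‖ := by
    rw [erase_inl_erase_inr_eq_disjSum, Finset.prod_disjSum, hAeq]
    refine mul_le_mul
      (localScale_pow_div_le_prod_zeroFactor hq0 hq1 fun k hk => hhalf j k _ hk ?_)
      (localScale_pow_div_le_prod_zeroFactor hq0 hq1 fun k hk => hhalf j k _ hk (hXY j k hk))
      (by positivity) (by positivity)
    exact half_le_self (abs_nonneg (X j - X k))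
  have hAj' : A ≤ ∏ k ∈ (Finset.univ.erase (Sum.inl j)).erase (Sum.inr j),
      ‖zeroFactor (z (Sum.inr j) - z k)‖ := by
    rw [erase_inl_erase_inr_eq_disjSum, Finset.prod_disjSum, hAeq]
    exact mul_le_mul
      (localScale_pow_div_le_prod_zeroFactor hq0 hq1 fun k hk => hhalf j k _ hk (hYX j k hk))
      (localScale_pow_div_le_prod_zeroFactor hq0 hq1 fun k hk => hhalf j k _ hk (hYY j k hk))
      (by positivity) (by positivity)
  have hsep : ∀ k ∈ (Finset.univ.erase (Sum.inl j)).erase (Sum.inr j),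
      localScale S q j / 10 ≤ ‖zeroFactor (z (Sum.inl j) - z k)‖ := by
    have hstep : ∀ t : ℝ, localScale S q j / 2 ≤ |t| →
        localScale S q j / 10 ≤ ‖zeroFactor t‖ := fun t ht => by
      refine le_trans ?_ (min_one_abs_le_norm_zeroFactor t)
      have : localScale S q j / 2 ≤ min 1 |t| := le_min (by linarith [hg1 j]) ht
      linarith
    rintro (k | k) hk
    · have hkj : k ≠ j := by rintro rfl; simp at hk
      exact hstep _ (by
        have := (hXX j k hkj).2.1
        simp only [hz, Sum.elim_inl]
        linarith)
    · have hkj : k ≠ j := by rintro rfl; simp at hk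
      exact hstep _ (by
        have := (hXX j k hkj).2.1
        have := hXY j k hkj
        simp only [hz, Sum.elim_inl, Sum.elim_inr]
        linarith)
  have hlocj : |z (Sum.inl j) - z (Sum.inr j)| < localScale S q j / 4 := hloc j
  have h4 : 4 ^ d * ε / A = 400 ^ d * ε / localScale S q j ^ (2 * (S.card - 1)) := by
    have h5 : (400 : ℝ) ^ d = 4 ^ d * 100 ^ d := by rw [← mul_pow]; norm_num
    rw [hA, h5]
    field_simp
  constructor
  · have h1 := norm_coeff_mul_prod_zeroFactor_le hz' (Sum.inl j)
    have hmem : Sum.inr j ∈ (Finset.univ : Finset (Fin d ⊕ Fin d)).erase (Sum.inl j) := by simp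
    rw [← Finset.mul_prod_erase _ _ hmem, hpow] at h1
    have h2 := min_one_abs_le_norm_zeroFactor (z (Sum.inl j) - z (Sum.inr j))
    rw [min_eq_right (by linarith [hg1 j])] at h2
    have h3 : m * (|X j - Y j| / 5 * A) ≤ 4 ^ d * ε := by
      refine le_trans ?_ h1
      have := haj j
      gcongr
      exact h2
    have h5 : 5 * 400 ^ d / m * ε / localScale S q j ^ (2 * (S.card - 1)) =
        5 / m * (4 ^ d * ε / A) := by rw [h4]; field_simp
    rw [h5, abs_sub_comm, div_mul_div_comm, le_div_iff₀ (by positivity)]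
    linarith
  -- M = 5/2 because the pair is closer than scale/4 = (5/2) · (scale/10).
  · have h1 := norm_coeff_add_coeff_le hz' (j := Sum.inl j) (j' := Sum.inr j) (by simp)
      (ρ := localScale S q j / 10) (M := 5 / 2) hA0 (by positivity) hAj hAj' hsep
      (by linarith [hg1 j]) (by linarith)
    have h2 : ‖c (Sum.inl j) + c (Sum.inr j)‖ = |b j - a j| := by
      have : c (Sum.inl j) + c (Sum.inr j) = ((b j - a j : ℝ) : ℂ) := by
        simp [hc]; ring
      rw [this, Complex.norm_real, Real.norm_eq_abs]
    rw [h2, hpow, h4, hcard] at h1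
    refine h1.trans ?_
    have h6 : 1 + 5 * (((2 * d : ℕ) : ℝ) / (localScale S q j / 10)) *
        Real.exp (((2 * d : ℕ) : ℝ) * (5 / 2)) ≤
        (1 + 100 * d * Real.exp (5 * d)) / localScale S q j := by
      have h7 : ((2 * d : ℕ) : ℝ) * (5 / 2) = 5 * d := by push_cast; ring
      rw [h7, add_div]
      have h8 : 1 ≤ 1 / localScale S q j := (one_le_div hgj).2 (hg1 j)
      have h9 : 5 * (((2 * d : ℕ) : ℝ) / (localScale S q j / 10)) * Real.exp (5 * d) =
        100 * d * Real.exp (5 * d) / localScale S q j := by push_cast; field_simp; ring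
      linarith
    calc _ ≤ 400 ^ d * ε / localScale S q j ^ (2 * (S.card - 1)) *
        ((1 + 100 * d * Real.exp (5 * d)) / localScale S q j) := by gcongr
      _ = _ := by rw [pow_succ]; field_simp

end TwoSignals

/-! ### Return to the original scale, and diameters. -/

theorem card_clusterIndices {d p κ : ℕ} (h : κ + p ≤ d) : (clusterIndices d p κ).card = p := by
  have h1 : (clusterIndices d p κ).map Fin.valEmbedding = Finset.Ico κ (κ + p) := by
    ext k
    simp only [clusterIndices, Finset.mem_map, Finset.mem_filter, Finset.mem_univ, true_and,
      Fin.valEmbedding_apply, Finset.mem_Ico]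
    exact ⟨by rintro ⟨i, hi, rfl⟩; exact hi, fun hk => ⟨⟨k, by omega⟩, hk, rfl⟩⟩
  rw [← Finset.card_map Fin.valEmbedding, h1, Nat.card_Ico, Nat.add_sub_cancel_left]

theorem ediam_le_of_abs_sub_le {s : Set ℝ} {x r : ℝ} (h : ∀ y ∈ s, |y - x| ≤ r) :
    Metric.ediam s ≤ ENNReal.ofReal (2 * r) := by
  refine Metric.ediam_le_iff.2 fun y hy w hw => ?_
  rw [edist_dist, Real.dist_eq]
  refine ENNReal.ofReal_le_ofReal ?_
  have h1 := abs_sub_le y x w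
  rw [abs_sub_comm x w] at h1
  linarith [h y hy, h w hw]

/-- Nodes are rescaled by Ω/d. Then |s| ≤ 2d corresponds to frequencies at most Ω/π, inside the
band; the lower bound on Ω gives separation 2 outside the cluster, and the upper bound gives q ≤ 1.
-/
theorem PositiveSignal.errorSet_bounds {d p κ : ℕ} {m h T τ η Ω ε : ℝ} {F G : PositiveSignal d}
    (hd : 0 < d) (hm : 0 < m) (hF : IsClusteredAt p h T τ η F.node κ) (ha : ∀ j, m ≤ F.amp j)
    (hΩ0 : 2 * d / (η * T) ≤ Ω) (hΩ1 : Ω ≤ d / h)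
    (hε : ε ≤ m / 2 * (1 / 400) ^ d / d ^ (2 * p - 1) * (Ω * τ * h) ^ (2 * p - 1))
    (hG : G ∈ F.errorSet ε Ω) (j : Fin d) :
    |G.node j - F.node j| ≤ d / Ω * (5 * 400 ^ d / m * ε /
      localScale (clusterIndices d p κ) (Ω * τ * h / d) j ^ (2 * (p - 1))) ∧
    |G.amp j - F.amp j| ≤ 400 ^ d * (1 + 100 * d * Real.exp (5 * d)) * ε /
      localScale (clusterIndices d p κ) (Ω * τ * h / d) j ^ (2 * (p - 1) + 1) := by
  have hcard := card_clusterIndices hF.index_le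
  have hd' : (0 : ℝ) < d := by exact_mod_cast hd
  have hh := hF.h_pos
  have hT : 0 < T := hh.trans_le hF.h_le
  have hη := hF.eta_pos
  have hτ := hF.tau_pos
  have hΩ : 0 < Ω := lt_of_lt_of_le (by positivity) hΩ0
  have hscale : 0 < Ω / d := by positivity
  have hdist : ∀ i k, |Ω / d * F.node i - Ω / d * F.node k| = Ω / d * |F.node i - F.node k| :=
    fun i k => by rw [← mul_sub, abs_mul, abs_of_pos hscale]
  have hFT : ∀ (H : PositiveSignal d) (s : ℝ),
      ∑ j, (H.amp j : ℂ) * Complex.exp (Complex.I * (s * ((Ω / d * H.node j : ℝ) : ℂ))) =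
        H.fourierTransform (-(s * Ω / (2 * Real.pi * d))) := by
    intro H s
    rw [H.fourierTransform_eq_sum]
    refine Finset.sum_congr rfl fun j _ => ?_
    congr 2
    have hpi : (Real.pi : ℂ) ≠ 0 := by exact_mod_cast Real.pi_ne_zero
    have hdc : (d : ℂ) ≠ 0 := by exact_mod_cast hd.ne'
    push_cast
    field_simp
  have hb := localized_bounds (S := clusterIndices d p κ) (q := Ω * τ * h / d)
    (X := fun j => Ω / d * F.node j) (Y := fun j => Ω / d * G.node j) (a := F.amp) (b := G.amp)
    (m := m) (ε := ε)
    (fun i k hik => mul_lt_mul_of_pos_left (F.node_strictMono hik) hscale)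
    (fun i k hik => mul_lt_mul_of_pos_left (G.node_strictMono hik) hscale)
    (by positivity)
    (by
      rw [div_le_one hd']
      rw [le_div_iff₀ hh] at hΩ1
      calc Ω * τ * h = τ * (Ω * h) := by ring
        _ ≤ 1 * (Ω * h) := by gcongr; exact hF.tau_le_one
        _ ≤ d := by linarith)
    hm
    (fun i hi k hk hik => by
      rw [hdist]
      calc Ω * τ * h / d = Ω / d * (τ * h) := by ring
        _ ≤ _ := by gcongr; exact (hF.cluster i hi k hk hik).1)
    (fun i hi k hik => by
      rw [hdist]
      rw [div_le_iff₀ (by positivity)] at hΩ0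
      calc (2 : ℝ) ≤ Ω / d * (η * T) := by
            rw [div_mul_eq_mul_div, le_div_iff₀ hd']; exact hΩ0
        _ ≤ _ := by gcongr; exact (hF.nonCluster i hi k hik).1)
    ha
    (fun s hs => by
      rw [hFT, hFT]
      refine hG _ (abs_le.1 ?_)
      rw [abs_neg, abs_div, abs_mul, abs_of_pos hΩ,
        abs_of_pos (show 0 < 2 * Real.pi * d by positivity), div_le_iff₀ (by positivity)]
      have h1 := Real.pi_gt_three
      calc |s| * Ω ≤ 2 * d * Ω := by gcongr
        _ ≤ 2 * d * Ω * Real.pi := le_mul_of_one_le_right (by positivity) (by linarith)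
        _ = _ := by ring)
    (by
      rw [hcard, div_pow (Ω * τ * h)]
      exact hε.trans_eq (by rw [div_mul_eq_mul_div, mul_div_assoc]))
    j
  rw [hcard] at hb
  refine ⟨?_, hb.2⟩
  have h1 := hb.1
  rw [← mul_sub, abs_mul, abs_of_pos hscale, div_mul_eq_mul_div, div_le_iff₀ hd'] at h1
  rw [div_mul_eq_mul_div, le_div_iff₀ hΩ]
  linarith

theorem one_div_localScale_pow_le {d n : ℕ} (hd : 0 < d) {S : Finset (Fin d)} {r : ℝ}
    (j : Fin d) :
    1 / localScale S (r / d) j ^ n ≤ d ^ n * (if j ∈ S then r ^ (-(n : ℤ)) else 1) := by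
  have hd' : (1 : ℝ) ≤ d := by exact_mod_cast hd
  unfold localScale
  split_ifs
  · rw [div_pow, one_div_div, zpow_neg, zpow_natCast, div_eq_mul_inv]
  · simpa using one_le_pow₀ hd'

theorem theorem2p6 (d p : ℕ) (m : ℝ) (hm : 0 < m) :
    ∃ C₁ C₂ C₃ C₄ C₅ : ℝ, 0 < C₁ ∧ 0 < C₂ ∧ 0 < C₃ ∧ 0 < C₄ ∧ 0 < C₅ ∧
      ∀ (h T τ η : ℝ) (F : PositiveSignal d) (κ : ℕ),
        IsClusteredAt p h T τ η F.node κ →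
        (∀ j, m ≤ F.amp j) →
        ∀ Ω ε : ℝ, C₄ / (η * T) ≤ Ω → Ω ≤ C₅ / h →
          0 < ε → ε ≤ C₃ * (Ω * τ * h) ^ (2 * p - 1) →
          ∀ j : Fin d,
            Metric.ediam (F.nodeErrorSet ε Ω j) ≤
              ENNReal.ofReal (C₁ / Ω * ε *
                (if j ∈ clusterIndices d p κ
                  then (Ω * τ * h) ^ (-2 * (p : ℤ) + 2) else 1)) ∧
            Metric.ediam (F.ampErrorSet ε Ω j) ≤
              ENNReal.ofReal (C₂ * ε *
                (if j ∈ clusterIndices d p κ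
                  then (Ω * τ * h) ^ (-2 * (p : ℤ) + 1) else 1)) := by
  rcases Nat.eq_zero_or_pos d with rfl | hd
  · exact ⟨1, 1, 1, 1, 1, one_pos, one_pos, one_pos, one_pos, one_pos,
      fun _ _ _ _ _ _ _ _ _ _ _ _ _ _ j => j.elim0⟩
  have hd' : (0 : ℝ) < d := by exact_mod_cast hd
  -- The leading 2 passes from radius to diameter; the powers of d undo q = Ωτh/d.
  refine ⟨2 * d * (5 * 400 ^ d / m) * d ^ (2 * (p - 1)),
    2 * (400 ^ d * (1 + 100 * d * Real.exp (5 * d))) * d ^ (2 * (p - 1) + 1),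
    m / 2 * (1 / 400) ^ d / d ^ (2 * p - 1), 2 * d, d, by positivity, by positivity,
    by positivity, by positivity, hd', ?_⟩
  intro h T τ η F κ hF ha Ω ε hΩ0 hΩ1 hε0 hε j
  have hT : 0 < T := hF.h_pos.trans_le hF.h_le
  have hη := hF.eta_pos
  have hΩ : 0 < Ω := lt_of_lt_of_le (by positivity) hΩ0
  have hp := hF.two_le
  have hb : ∀ G ∈ F.errorSet ε Ω, _ := fun G hG =>
    PositiveSignal.errorSet_bounds hd hm hF ha hΩ0 hΩ1 hε hG j
  -- The truncated subtraction p - 1 is exact since p ≥ 2.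
  have he1 : (-2 * (p : ℤ) + 2) = -((2 * (p - 1) : ℕ) : ℤ) := by omega
  have he2 : (-2 * (p : ℤ) + 1) = -((2 * (p - 1) + 1 : ℕ) : ℤ) := by omega
  rw [he1, he2]
  constructor
  · refine (ediam_le_of_abs_sub_le (x := F.node j)
      (by rintro _ ⟨G, hG, rfl⟩; exact (hb G hG).1)).trans (ENNReal.ofReal_le_ofReal ?_)
    have h1 := one_div_localScale_pow_le (n := 2 * (p - 1)) hd (S := clusterIndices d p κ)
      (r := Ω * τ * h) j
    rw [div_eq_mul_one_div (5 * 400 ^ d / m * ε)]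
    calc
    _ ≤ 2 * (d / Ω * (5 * 400 ^ d / m * ε * (d ^ (2 * (p - 1)) *
          (if j ∈ clusterIndices d p κ then (Ω * τ * h) ^ (-((2 * (p - 1) : ℕ) : ℤ)) else 1)))) := by
        gcongr
    _ = _ := by ring
  · refine (ediam_le_of_abs_sub_le (x := F.amp j)
      (by rintro _ ⟨G, hG, rfl⟩; exact (hb G hG).2)).trans (ENNReal.ofReal_le_ofReal ?_)
    have h1 := one_div_localScale_pow_le (n := 2 * (p - 1) + 1) hd (S := clusterIndices d p κ)
      (r := Ω * τ * h) j
    rw [div_eq_mul_one_div (400 ^ d * _ * ε)]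
    calc
    _ ≤ 2 * (400 ^ d * (1 + 100 * d * Real.exp (5 * d)) * ε * (d ^ (2 * (p - 1) + 1) *
          (if j ∈ clusterIndices d p κ then
            (Ω * τ * h) ^ (-((2 * (p - 1) + 1 : ℕ) : ℤ)) else 1))) := by
        gcongr
    _ = _ := by ring
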